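/- A \emph{stick knot} is a simple closed polygon $K\subset\mathbb{R}^3$, a finite union of line segments called \emph{sticks}. Two stick knots are \emph{equivalent} (equivalently, p.l. ambient isotopic) if they are related by a finite sequence of triangle moves and their inverses; a triangle move applies when $K$ meets a nondegenerate triangle $abc$ exactly in the side $ab$, and replaces that side by $ac\cup cb$. Let $\mathbb{L}^3=\mathbb{R}\times\mathbb{Z}\times\mathbb{Z}\,\cup\,\mathbb{Z}\times\mathbb{R}\times\mathbb{Z}\,\cup\,\mathbb{Z}\times\mathbb{Z}\times\mathbb{R}$ be the simple cubic lattice. The \emph{lattice stick number} $s_{CL}[K]$ is the minimum number of sticks of a stick knot contained in $\mathbb{L}^3$ and equivalent to $K$. A \emph{lattice rail arc} $r$ for two distinct parallel lines $\ell_1,\ell_2\subset\mathbb{L}^3$ (the \emph{rails}) is a simple polygonal arc contained in $\mathbb{L}^3$, with one endpoint on $\ell_1$, the other on $\ell_2$, and interior disjoint from $\ell_1\cup\ell_2$. Choose one of the two directions along the rails as upwards, and project along the rails. Let $\alpha$ be a polygonal arc joining the endpoints of $r$ whose projection is a simple arc and which lies strictly below (respectively, strictly above) $r$ wherever their projections meet,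 apart from the common endpoints. The equivalence class of $r\cup\alpha$ is called the \emph{under} (respectively, \emph{over}) \emph{companion} of $r$; it does not depend on the choice of $\alpha$. The \emph{rail lattice stick number} $rs_{CL}[K]$ is the minimum number of sticks of a lattice rail arc whose under or over companion is the class of $K$. \textbf{Theorem.} For every knot $K$, \[ s_{CL}[K]-4\le rs_{CL}[K]. \] -/

import Mathlib

namespace RailKnot

/-- Three-dimensional space. Only its affine structure is used. -/
abbrev R3 : Type := Fin 3 → ℝ

/-- The simple cubic lattice `ℝ × ℤ × ℤ ∪ ℤ × ℝ × ℤ ∪ ℤ × ℤ × ℝ`. -/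
def cubicLattice : Set R3 :=
  {x | (∃ a b : ℤ, x 1 = a ∧ x 2 = b) ∨ (∃ a b : ℤ, x 0 = a ∧ x 2 = b) ∨
    (∃ a b : ℤ, x 0 = a ∧ x 1 = b)}

/-- The union of the `n` sticks `[v 0, v 1], …, [v (n - 1), v n]`. -/
def sticks (n : ℕ) (v : ℕ → R3) : Set R3 :=
  {x | ∃ i < n, x ∈ segment ℝ (v i) (v (i + 1))}

/-- The point with parameter `s ∈ [0, 1]` on the `i`-th stick. -/
def stickPoint (v : ℕ → R3) (i : ℕ) (s : ℝ) : R3 :=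
  AffineMap.lineMap (v i) (v (i + 1)) s

/-- `v 0, …, v n` are the successive vertices of a simple polygonal arc with `n` sticks:
the parametrization of the polygonal path by `[0, n]` is injective. -/
def IsStickArc (n : ℕ) (v : ℕ → R3) : Prop :=
  ∀ i < n, ∀ j < n, ∀ s ∈ Set.Icc (0 : ℝ) 1, ∀ t ∈ Set.Icc (0 : ℝ) 1,
    stickPoint v i s = stickPoint v j t → (i : ℝ) + s = j + t

/-- `K` is a simple closed polygon (a p.l. knot) made of `n` sticks: there is a closed polygonal
path with `n` sticks and image `K` whose parametrization by `[0, n)` is injective. -/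
def IsStickKnot (n : ℕ) (K : Set R3) : Prop :=
  3 ≤ n ∧ ∃ v : ℕ → R3, v n = v 0 ∧ K = sticks n v ∧
    ∀ i < n, ∀ j < n, ∀ s ∈ Set.Ico (0 : ℝ) 1, ∀ t ∈ Set.Ico (0 : ℝ) 1,
      stickPoint v i s = stickPoint v j t → i = j ∧ s = t

/-- A triangle move: `K` meets a nondegenerate triangle `abc` exactly in the side `[a, b]`, and
`K'` arises from `K` by replacing that side with `[a, c] ∪ [c, b]`. The side `[a, b]` may be a
proper part of a stick of `K`, so subdivisions need no separate move. -/
def TriangleMove (K K' : Set R3) : Prop :=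
  ∃ a b c : R3, AffineIndependent ℝ ![a, b, c] ∧
    K ∩ convexHull ℝ {a, b, c} = segment ℝ a b ∧
    K' = (K \ segment ℝ a b) ∪ (segment ℝ a c ∪ segment ℝ c b)

/-- Equivalence of p.l. knots: a finite sequence of triangle moves and inverse triangle moves.
(Such moves carry simple closed polygons to simple closed polygons.) -/
def KnotEquiv : Set R3 → Set R3 → Prop :=
  Relation.EqvGen TriangleMove

/-- The line through `p` with direction `d`. -/
def line (p d : R3) : Set R3 :=
  {x | ∃ t : ℝ, x = p + t • d}

/-- The polygonal path `v 0, …, v n` is a stick rail arc for the two distinct parallel rails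
`line p d` and `line q d`. -/
structure IsStickRailArc (p q d : R3) (n : ℕ) (v : ℕ → R3) : Prop where
  direction_ne_zero : d ≠ 0
  rails_ne : line p d ≠ line q d
  simple : IsStickArc n v
  start_mem : v 0 ∈ line p d
  end_mem : v n ∈ line q d
  interior_disjoint : ∀ x ∈ sticks n v, x ∈ line p d ∪ line q d → x = v 0 ∨ x = v n

/-- A lattice rail arc: the arc and both rails are contained in the cubic lattice. -/
structure IsLatticeRailArc (p q d : R3) (n : ℕ) (v : ℕ → R3) : Prop
    extends IsStickRailArc p q d n v where
  rail_subset : line p d ⊆ cubicLattice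
  rail_subset' : line q d ⊆ cubicLattice
  arc_subset : sticks n v ⊆ cubicLattice

/-- The polygonal path `w 0, …, w m` is an underpass for the arc `v 0, …, v n`, where the rails
have direction `d` and `d` points upwards: it joins the endpoints of the arc; its projection to a
plane perpendicular to `d` is a simple arc; and wherever its projection meets the projection of
the arc, other than at the common endpoints, it is the lower strand. Two points have the same
projection exactly if they differ by a multiple of `d`. -/
structure IsUnderpass (d : R3) (n : ℕ) (v : ℕ → R3) (m : ℕ) (w : ℕ → R3) : Prop where
  start_eq : w 0 = v n
  end_eq : w m = v 0
  projection_simple : ∀ i < m, ∀ j < m, ∀ s ∈ Set.Icc (0 : ℝ) 1, ∀ t ∈ Set.Icc (0 : ℝ) 1,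
    ∀ u : ℝ, stickPoint w i s = stickPoint w j t + u • d → (i : ℝ) + s = j + t
  below : ∀ x ∈ sticks n v, ∀ y ∈ sticks m w, ∀ u : ℝ, x = y + u • d →
    0 < u ∨ x = v 0 ∨ x = v n

/-- An overpass is an underpass seen from the opposite side. -/
def IsOverpass (d : R3) (n : ℕ) (v : ℕ → R3) (m : ℕ) (w : ℕ → R3) : Prop :=
  IsUnderpass (-d) n v m w

/-- The class of `K` is the under companion of the rail arc `v`. -/
def IsUnderCompanion (d : R3) (n : ℕ) (v : ℕ → R3) (K : Set R3) : Prop :=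
  ∃ (m : ℕ) (w : ℕ → R3), IsUnderpass d n v m w ∧ KnotEquiv (sticks n v ∪ sticks m w) K

/-- The class of `K` is the over companion of the rail arc `v`. -/
def IsOverCompanion (d : R3) (n : ℕ) (v : ℕ → R3) (K : Set R3) : Prop :=
  ∃ (m : ℕ) (w : ℕ → R3), IsOverpass d n v m w ∧ KnotEquiv (sticks n v ∪ sticks m w) K

/-- The lattice stick number of the class of `K`: the least `n` such that some lattice knot
with `n` sticks is equivalent to `K` (`⊤` if there were none). -/
noncomputable def latticeStickNumber (K : Set R3) : ℕ∞ :=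
  sInf {N | ∃ n : ℕ, N = n ∧
    ∃ L : Set R3, IsStickKnot n L ∧ L ⊆ cubicLattice ∧ KnotEquiv L K}

/-- The rail lattice stick number of the class of `K`: the least `n` such that some lattice rail
arc with `n` sticks has the class of `K` as its under or over companion (`⊤` if there were
none). -/
noncomputable def railLatticeStickNumber (K : Set R3) : ℕ∞ :=
  sInf {N | ∃ n : ℕ, N = n ∧ ∃ (p q d : R3) (v : ℕ → R3), IsLatticeRailArc p q d n v ∧
    (IsUnderCompanion d n v K ∨ IsOverCompanion d n v K)}

end RailKnot

namespace RailKnot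

/-! ### Triangle moves -/

/-! A minimal lattice rail arc is closed up by four lattice sticks: drop along one rail to a level
below everything, cross at that level with two axis-parallel sticks, and rise along the other rail.
The interior of the arc misses the rails and the arc stays above the low level, so the polygon is
simple (`exists_lattice_underCompanion`). Over companions reduce to under companions by reversing
the direction `d`.

The substance is that this closure is equivalent to the one by the given underpass `w`. Below each
stick of `w` hangs a curtain, which the rail arc and the earlier sticks meet at most in endpoints of
the stick (`IsUnderpass.eq_of_mem_curtain`). Hence `w` can be cut short from its end backwards:
`cutShort` at `i` leaves `w` at `w i`, drops to a low level and runs straight to the rail.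
`knotEquiv_cutShort_last` creates the detour at the last stick, and `knotEquiv_cutShort_succ`
absorbs one more stick while raising the level, so that the low segment stays out of the way. At `i
= 0` nothing of `w` is left (`knotEquiv_cutShort_zero`). The straight crossing is then bent to a
lattice corner (`exists_corner`). -/

theorem KnotEquiv.refl (K : Set R3) : KnotEquiv K K := Relation.EqvGen.refl K

theorem KnotEquiv.symm {K L : Set R3} (h : KnotEquiv K L) : KnotEquiv L K :=
  Relation.EqvGen.symm _ _ h

theorem KnotEquiv.trans {K L M : Set R3} (h : KnotEquiv K L) (h' : KnotEquiv L M) :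
    KnotEquiv K M :=
  Relation.EqvGen.trans _ _ _ h h'

theorem mem_triangle {a b c x : R3} (hx : x ∈ convexHull ℝ {a, b, c}) :
    ∃ r s t : ℝ, 0 ≤ r ∧ 0 ≤ s ∧ 0 ≤ t ∧ r + s + t = 1 ∧ x = r • a + s • b + t • c := by
  rw [convexHull_insert (by simp), convexHull_pair, mem_convexJoin] at hx
  obtain ⟨a', ha', y, ⟨s, t, hs, ht, hst, rfl⟩, ⟨p, q, hp, hq, hpq, rfl⟩⟩ := hx
  rw [Set.mem_singleton_iff] at ha'
  subst ha'
  refine ⟨p, q * s, q * t, hp, mul_nonneg hq hs, mul_nonneg hq ht, ?_, ?_⟩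
  · rw [add_assoc, ← mul_add, hst, mul_one, hpq]
  · rw [smul_add, smul_smul, smul_smul, add_assoc]

/-- Replacing the side `[a, b]` of a triangle by the two others is an equivalence if the rest of
the knot meets the triangle at most in `a` and `b`. -/
theorem knotEquiv_triangle {R : Set R3} {a b c : R3} (hi : AffineIndependent ℝ ![a, b, c])
    (hR : ∀ x ∈ R, x ∈ convexHull ℝ {a, b, c} → x = a ∨ x = b) :
    KnotEquiv (R ∪ segment ℝ a b) (R ∪ (segment ℝ a c ∪ segment ℝ c b)) := by
  have hab : segment ℝ a b ⊆ convexHull ℝ {a, b, c} := by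
    rw [← convexHull_pair]
    exact convexHull_mono (by intro x; simp; tauto)
  refine Relation.EqvGen.rel _ _ ⟨a, b, c, hi, ?_, ?_⟩
  · ext x
    constructor
    · rintro ⟨hx | hx, hx'⟩
      · rcases hR x hx hx' with rfl | rfl
        · exact left_mem_segment _ _ _
        · exact right_mem_segment _ _ _
      · exact hx
    · exact fun hx => ⟨Or.inr hx, hab hx⟩
  · ext x
    constructor
    · rintro (hx | hx)
      -- The move deletes the closed side; the endpoints, which may lie in `R`, come back with the
      -- two new sides.
      · by_cases hx' : x ∈ segment ℝ a b
        · rcases hR x hx (hab hx') with rfl | rfl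
          · exact Or.inr (Or.inl (left_mem_segment _ _ _))
          · exact Or.inr (Or.inr (right_mem_segment _ _ _))
        · exact Or.inl ⟨Or.inl hx, hx'⟩
      · exact Or.inr hx
    · rintro (⟨hx | hx, hx'⟩ | hx)
      · exact Or.inl hx
      · exact absurd hx hx'
      · exact Or.inr hx

theorem affineIndependent_triple {a b c : R3}
    (h : ∀ s t : ℝ, s • (b - a) + t • (c - a) = 0 → s = 0 ∧ t = 0) :
    AffineIndependent ℝ ![a, b, c] := by
  rw [affineIndependent_iff_not_collinear_set, collinear_iff_of_mem (p₀ := a) (by simp)]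
  rintro ⟨e, he⟩
  obtain ⟨r, hr⟩ := he b (by simp)
  obtain ⟨q, hq⟩ := he c (by simp)
  have hb : b - a = r • e := by rw [hr]; simp
  have hc : c - a = q • e := by rw [hq]; simp
  -- On a common line, `q • (b - a) = r • (c - a)`. This forces `r = 0`, so `b = a`, and the
  -- coefficients `1, 0` contradict independence.
  have h1 := h q (-r) (by rw [hb, hc, smul_smul, smul_smul, ← add_smul]; ring_nf; simp)
  have h2 := h 1 0 (by rw [hb, neg_eq_zero.1 h1.2]; simp)
  exact one_ne_zero h2.1

/-- One side of the triangle is parallel to `d` and another is not. This is the shape of most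
triangles used below. -/
theorem affineIndependent_of_vertical_right {a b c d : R3} {u : ℝ} (hd : d ≠ 0)
    (hab : ∀ r : ℝ, b - a ≠ r • d) (hu : u ≠ 0) (hc : c = b + u • d) :
    AffineIndependent ℝ ![a, b, c] := by
  refine affineIndependent_triple fun s t h => ?_
  subst hc
  have h' : (s + t) • (b - a) = (-(t * u)) • d := by
    linear_combination (norm := module) h
  by_cases hst : s + t = 0
  · rw [hst, zero_smul, eq_comm, smul_eq_zero] at h'
    have ht : t = 0 := by simpa [hd, hu] using h'
    exact ⟨by linarith, ht⟩
  · exact absurd (by rw [div_eq_inv_mul, mul_smul, ← h', inv_smul_smul₀ hst])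
      (hab (-(t * u) / (s + t)))

theorem affineIndependent_of_vertical_left {a b c d : R3} {u : ℝ} (hd : d ≠ 0)
    (hab : ∀ r : ℝ, b - a ≠ r • d) (hu : u ≠ 0) (hc : c = a + u • d) :
    AffineIndependent ℝ ![a, b, c] := by
  refine affineIndependent_triple fun s t h => ?_
  subst hc
  have h' : s • (b - a) = (-(t * u)) • d := by
    linear_combination (norm := module) h
  by_cases hst : s = 0
  · rw [hst, zero_smul, eq_comm, smul_eq_zero] at h'
    exact ⟨hst, by simpa [hd, hu] using h'⟩
  · exact absurd (by rw [div_eq_inv_mul, mul_smul, ← h', inv_smul_smul₀ hst])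
      (hab (-(t * u) / s))

theorem affineIndependent_of_level {a b c : R3} (ℓ : R3 →ₗ[ℝ] ℝ) (hbc : b ≠ c)
    (h : ℓ b = ℓ c) (hab : ℓ a ≠ ℓ b) : AffineIndependent ℝ ![a, b, c] := by
  refine affineIndependent_triple fun s t hst => ?_
  have h1 : (s + t) * (ℓ b - ℓ a) = 0 := by
    have := congrArg ℓ hst
    simp only [map_add, map_smul, map_sub, smul_eq_mul, map_zero, ← h] at this
    linarith
  have h2 : s + t = 0 := by
    rcases mul_eq_zero.1 h1 with h1 | h1
    · exact h1
    · exact absurd (by linarith) hab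
  have hs : s = -t := by linarith
  subst hs
  have h3 : t • (c - b) = 0 := by linear_combination (norm := module) hst
  rcases smul_eq_zero.1 h3 with h3 | h3
  · simp [h3]
  · exact absurd (sub_eq_zero.1 h3).symm hbc

/-! ### Sticks -/

theorem sticks_zero (v : ℕ → R3) : sticks 0 v = ∅ := by
  ext x; simp [sticks]

theorem sticks_succ (n : ℕ) (v : ℕ → R3) :
    sticks (n + 1) v = sticks n v ∪ segment ℝ (v n) (v (n + 1)) := by
  ext x
  constructor
  · rintro ⟨i, hi, hx⟩
    rcases Nat.lt_succ_iff_lt_or_eq.1 hi with hi | rfl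
    · exact Or.inl ⟨i, hi, hx⟩
    · exact Or.inr hx
  · rintro (⟨i, hi, hx⟩ | hx)
    · exact ⟨i, by omega, hx⟩
    · exact ⟨n, by omega, hx⟩

theorem sticks_mono {i m : ℕ} (h : i ≤ m) (w : ℕ → R3) : sticks i w ⊆ sticks m w :=
  fun _ ⟨j, hj, hx⟩ => ⟨j, hj.trans_le h, hx⟩

theorem mem_segment_iff_stickPoint {v : ℕ → R3} {i : ℕ} {x : R3} :
    x ∈ segment ℝ (v i) (v (i + 1)) ↔ ∃ s ∈ Set.Icc (0 : ℝ) 1, stickPoint v i s = x := by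
  rw [segment_eq_image_lineMap]; rfl

@[simp] theorem stickPoint_zero (v : ℕ → R3) (i : ℕ) : stickPoint v i 0 = v i := by
  simp [stickPoint]

@[simp] theorem stickPoint_one (v : ℕ → R3) (i : ℕ) : stickPoint v i 1 = v (i + 1) := by
  simp [stickPoint]

theorem vertex_mem_sticks {n i : ℕ} (hn : 0 < n) (hi : i ≤ n) (v : ℕ → R3) :
    v i ∈ sticks n v := by
  rcases hi.lt_or_eq with hi | rfl
  · exact ⟨i, hi, left_mem_segment _ _ _⟩
  · obtain ⟨k, rfl⟩ := Nat.exists_eq_succ_of_ne_zero hn.ne'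
    exact ⟨k, k.lt_succ_self, right_mem_segment _ _ _⟩

theorem exists_lt_height (ℓ : R3 →ₗ[ℝ] ℝ) (n : ℕ) (v : ℕ → R3) :
    ∃ h : ℝ, ∀ x ∈ sticks n v, h < ℓ x := by
  induction n with
  | zero => exact ⟨0, by simp [sticks_zero]⟩
  | succ n ih =>
    obtain ⟨h, hh⟩ := ih
    -- A linear form on a segment is at least its smaller endpoint value; subtracting 1 makes the
    -- bound strict.
    refine ⟨min h (min (ℓ (v n)) (ℓ (v (n + 1))) - 1), fun x hx => ?_⟩
    rw [sticks_succ] at hx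
    rcases hx with hx | ⟨s, t, hs, ht, hst, rfl⟩
    · exact (min_le_left _ _).trans_lt (hh x hx)
    · refine (min_le_right _ _).trans_lt ?_
      simp only [map_add, map_smul, smul_eq_mul]
      have h1 := min_le_left (ℓ (v n)) (ℓ (v (n + 1)))
      have h2 := min_le_right (ℓ (v n)) (ℓ (v (n + 1)))
      have h3 := mul_le_mul_of_nonneg_left h1 hs
      have h4 := mul_le_mul_of_nonneg_left h2 ht
      have h5 : s * min (ℓ (v n)) (ℓ (v (n + 1))) + t * min (ℓ (v n)) (ℓ (v (n + 1)))
          = min (ℓ (v n)) (ℓ (v (n + 1))) := by rw [← add_mul, hst, one_mul]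
      linarith

/-! ### Levels and curtains -/

/-- The point of level `t` on the line through `x` with direction `d`. -/
def dropTo (ℓ : R3 →ₗ[ℝ] ℝ) (d x : R3) (t : ℝ) : R3 := x + (t - ℓ x) • d

theorem height_dropTo {ℓ : R3 →ₗ[ℝ] ℝ} {d : R3} (hd : ℓ d = 1) (x : R3) (t : ℝ) :
    ℓ (dropTo ℓ d x t) = t := by
  simp [dropTo, hd]

/-- The points on or below the segment `[a, b]`. -/
def curtain (d a b : R3) : Set R3 := {z | ∃ y ∈ segment ℝ a b, ∃ u : ℝ, 0 ≤ u ∧ y = z + u • d}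

theorem convex_curtain (d a b : R3) : Convex ℝ (curtain d a b) := by
  rintro x ⟨y, hy, u, hu, rfl⟩ x' ⟨y', hy', u', hu', rfl⟩ s t hs ht hst
  refine ⟨_, convex_segment a b hy hy' hs ht hst, s * u + t * u', by positivity, ?_⟩
  module

theorem left_mem_curtain {ℓ : R3 →ₗ[ℝ] ℝ} (d a b : R3) {t : ℝ} (h : t ≤ ℓ a) :
    dropTo ℓ d a t ∈ curtain d a b :=
  ⟨a, left_mem_segment _ _ _, ℓ a - t, by linarith, by rw [dropTo]; module⟩

theorem right_mem_curtain {ℓ : R3 →ₗ[ℝ] ℝ} (d a b : R3) {t : ℝ} (h : t ≤ ℓ b) :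
    dropTo ℓ d b t ∈ curtain d a b :=
  ⟨b, right_mem_segment _ _ _, ℓ b - t, by linarith, by rw [dropTo]; module⟩

theorem segment_subset_curtain (d a b : R3) : segment ℝ a b ⊆ curtain d a b :=
  fun x hx => ⟨x, hx, 0, le_rfl, by simp⟩

theorem triangle_subset {s : Set R3} (hs : Convex ℝ s) {a b c : R3} (ha : a ∈ s) (hb : b ∈ s)
    (hc : c ∈ s) : convexHull ℝ {a, b, c} ⊆ s :=
  convexHull_min (by rintro x (rfl | rfl | rfl) <;> assumption) hs

/-- The points of a vertical segment lie on the line of its endpoint. -/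
theorem exists_of_mem_segment_dropTo {ℓ : R3 →ₗ[ℝ] ℝ} {d a x : R3} {t : ℝ}
    (hx : x ∈ segment ℝ a (dropTo ℓ d a t)) : ∃ u : ℝ, x = a + u • d := by
  obtain ⟨r, s, _, _, hrs, rfl⟩ := hx
  refine ⟨s * (t - ℓ a), ?_⟩
  obtain rfl : r = 1 - s := by linarith
  rw [dropTo]; module

theorem eq_left_of_height_le {ℓ : R3 →ₗ[ℝ] ℝ} {a b x : R3} (h : ℓ a < ℓ b)
    (hx : x ∈ segment ℝ a b) (hxa : ℓ x ≤ ℓ a) : x = a := by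
  obtain ⟨r, s, _, hs, hrs, rfl⟩ := hx
  simp only [map_add, map_smul, smul_eq_mul] at hxa
  obtain rfl : r = 1 - s := by linarith
  obtain rfl : s = 0 := by nlinarith
  simp

theorem height_le_of_mem_triangle {ℓ : R3 →ₗ[ℝ] ℝ} {a b c x : R3} {h : ℝ}
    (hx : x ∈ convexHull ℝ {a, b, c}) (ha : ℓ a ≤ h) (hb : ℓ b ≤ h) (hc : ℓ c ≤ h) :
    ℓ x ≤ h :=
  triangle_subset (convex_halfSpace_le ℓ.isLinear h) ha hb hc hx

theorem height_eq_of_mem_segment {ℓ : R3 →ₗ[ℝ] ℝ} {a b x : R3} {h : ℝ}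
    (hx : x ∈ segment ℝ a b) (ha : ℓ a = h) (hb : ℓ b = h) : ℓ x = h := by
  obtain ⟨r, s, _, _, hrs, rfl⟩ := hx
  simp only [map_add, map_smul, smul_eq_mul, ha, hb]
  rw [← add_mul, hrs, one_mul]

/-- The unique lowest vertex is the only point of the triangle at its level. A horizontal segment
leaving that vertex therefore does not obstruct a move. -/
theorem eq_apex_of_height_le {ℓ : R3 →ₗ[ℝ] ℝ} {a b c x : R3} (ha : ℓ b < ℓ a) (hc : ℓ b < ℓ c)
    (hx : x ∈ convexHull ℝ {a, b, c}) (hxb : ℓ x ≤ ℓ b) : x = b := by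
  obtain ⟨r, s, t, hr, hs, ht, h1, rfl⟩ := mem_triangle hx
  simp only [map_add, map_smul, smul_eq_mul] at hxb
  obtain rfl : s = 1 - r - t := by linarith
  have hr0 : r = 0 := by nlinarith [mul_nonneg hr (sub_pos.2 ha).le, mul_nonneg ht (sub_pos.2 hc).le]
  subst hr0
  have ht0 : t = 0 := by nlinarith
  subst ht0
  simp

/-! ### Flattening an underpass -/

namespace IsUnderpass

variable {d : R3} {n m : ℕ} {v w : ℕ → R3}

/-- Simplicity of the projection gives `j + s = i + t` with `j < i`, which leaves only `j + 1 = i`,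
`s = 1`, `t = 0`. -/
theorem eq_of_mem_sticks (hw : IsUnderpass d n v m w) {i : ℕ} (hi : i < m) {x y : R3} {u : ℝ}
    (hx : x ∈ sticks i w) (hy : y ∈ segment ℝ (w i) (w (i + 1))) (h : x = y + u • d) :
    x = w i := by
  obtain ⟨j, hj, hx⟩ := hx
  obtain ⟨s, hs, rfl⟩ := mem_segment_iff_stickPoint.1 hx
  obtain ⟨t, ht, rfl⟩ := mem_segment_iff_stickPoint.1 hy
  have h1 := hw.projection_simple j (hj.trans hi) i hi s hs t ht u h
  have h2 : (j : ℝ) + 1 ≤ i := by exact_mod_cast hj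
  have h3 : s = 1 := le_antisymm hs.2 (by linarith [ht.1])
  have h4 : j + 1 = i := by
    have : (j : ℝ) + 1 = i := le_antisymm h2 (by linarith [ht.1])
    exact_mod_cast this
  rw [h3, stickPoint_one, h4]

theorem last_eq (hw : IsUnderpass d n v m w) {i : ℕ} (hi : i < m) {y : R3} {u : ℝ}
    (hy : y ∈ segment ℝ (w i) (w (i + 1))) (h : w m = y + u • d) : i + 1 = m := by
  obtain ⟨k, rfl⟩ := Nat.exists_eq_add_one_of_ne_zero (Nat.ne_zero_of_lt hi)
  obtain ⟨t, ht, rfl⟩ := mem_segment_iff_stickPoint.1 hy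
  have h1 := hw.projection_simple k k.lt_succ_self i hi 1 (by simp) t ht u (by simpa using h)
  have h2 : (k : ℝ) ≤ i := by linarith [ht.2]
  have h3 : k ≤ i := by exact_mod_cast h2
  omega

theorem first_eq (hw : IsUnderpass d n v m w) {i : ℕ} (hi : i < m) {y : R3} {u : ℝ}
    (hy : y ∈ segment ℝ (w i) (w (i + 1))) (h : w 0 = y + u • d) : i = 0 := by
  obtain ⟨t, ht, rfl⟩ := mem_segment_iff_stickPoint.1 hy
  have h1 := hw.projection_simple 0 (by omega) i hi 0 (by simp) t ht u (by simpa using h)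
  have h2 : (i : ℝ) ≤ 0 := by push_cast at h1; linarith [ht.1]
  exact_mod_cast le_antisymm h2 (by positivity)

/-- Different vertices of an underpass have different projections. -/
theorem vertex_ne (hw : IsUnderpass d n v m w) {i j : ℕ} (hi : i ≤ m) (hj : j < m) (hij : i ≠ j)
    (r : ℝ) : w i - w j ≠ r • d := by
  intro h
  have h' : w i = w j + r • d := by rw [← h]; module
  rcases hi.lt_or_eq with hi | rfl
  · have := hw.projection_simple i hi j hj 0 (by simp) 0 (by simp) r (by simpa using h')
    exact hij (by exact_mod_cast (add_right_cancel this))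
  -- The final vertex starts no stick, so it is read as the point with parameter 1 on the last one.
  · obtain ⟨k, rfl⟩ := Nat.exists_eq_add_one_of_ne_zero (Nat.ne_zero_of_lt hj)
    have := hw.projection_simple k k.lt_succ_self j hj 1 (by simp) 0 (by simp) r
      (by simpa using h')
    exact hij (by exact_mod_cast (this.trans (add_zero _)))

/-- The curtain below a stick of an underpass meets the rail arc and the preceding sticks at most
in the endpoints of the stick. -/
theorem eq_of_mem_curtain (hw : IsUnderpass d n v m w) {i : ℕ} (hi : i < m) {x : R3}
    (hx : x ∈ sticks n v ∪ sticks i w) (hx' : x ∈ curtain d (w i) (w (i + 1))) :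
    x = w i ∨ (i + 1 = m ∧ x = w m) := by
  obtain ⟨y, hy, u, hu, hyx⟩ := hx'
  have hxy : x = y + (-u) • d := by rw [hyx]; module
  rcases hx with hx | hx
  -- A point of the arc on or below the underpass must be an endpoint of the arc, that is `w m` or
  -- `w 0`, and these project only to the last and the first stick respectively.
  · rcases hw.below x hx y ⟨i, hi, hy⟩ _ hxy with h | h | h
    · linarith
    · rw [← hw.end_eq] at h
      exact Or.inr ⟨hw.last_eq hi hy (h ▸ hxy), h⟩
    · rw [← hw.start_eq] at h
      obtain rfl := hw.first_eq hi hy (h ▸ hxy)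
      exact Or.inl h
  · exact Or.inl (hw.eq_of_mem_sticks hi hx hy hxy)

end IsUnderpass

theorem segment_eq_union {a b c : R3} (h : b ∈ segment ℝ a c) :
    segment ℝ a c = segment ℝ a b ∪ segment ℝ b c := by
  apply subset_antisymm
  · have hb : b ∈ Set.range (AffineMap.lineMap a c : ℝ → R3) := by
      rw [segment_eq_image_lineMap] at h
      exact Set.image_subset_range _ _ h
    rw [← insert_endpoints_openSegment]
    rintro x (rfl | rfl | hx)
    · exact Or.inl (left_mem_segment _ _ _)
    · exact Or.inr (right_mem_segment _ _ _)
    · rcases openSegment_subset_union a c hb hx with rfl | hx | hx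
      · exact Or.inl (right_mem_segment _ _ _)
      · exact Or.inl (openSegment_subset_segment _ _ _ hx)
      · exact Or.inr (openSegment_subset_segment _ _ _ hx)
  · exact Set.union_subset ((convex_segment a c).segment_subset (left_mem_segment _ _ _) h)
      ((convex_segment a c).segment_subset h (right_mem_segment _ _ _))

theorem dropTo_mem_segment {ℓ : R3 →ₗ[ℝ] ℝ} {d x : R3} {h h' : ℝ} (h1 : h < h')
    (h2 : h' < ℓ x) : dropTo ℓ d x h' ∈ segment ℝ x (dropTo ℓ d x h) := by
  have h3 : 0 < ℓ x - h := by linarith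
  refine ⟨(h' - h) / (ℓ x - h), (ℓ x - h') / (ℓ x - h), by apply div_nonneg <;> linarith,
    by apply div_nonneg <;> linarith, by field_simp; ring, ?_⟩
  simp only [dropTo]
  match_scalars <;> field_simp <;> ring

/-- A triangle meets the vertical line through its vertex `b` only in `b` if this line misses the
opposite side. -/
theorem eq_vertex_of_mem_column {a b c d x : R3}
    (h : ∀ y ∈ segment ℝ a c, ∀ r : ℝ, b ≠ y + r • d) (hx : x ∈ convexHull ℝ {a, b, c}) {r : ℝ}
    (hxb : x = b + r • d) : x = b := by
  obtain ⟨p, q, s, hp, hq, hs, h1, h2⟩ := mem_triangle hx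
  rcases (add_nonneg hp hs).eq_or_lt with h0 | h0
  · obtain rfl : p = 0 := by linarith
    obtain rfl : s = 0 := by linarith
    obtain rfl : q = 1 := by linarith
    simpa using h2
  -- Modulo `d`, the equation reads `(p + s) b = p a + s c`; dividing by `p + s` puts `b` on the
  -- line of a point of `[a, c]`.
  · refine absurd ?_ (h _ ⟨p / (p + s), s / (p + s), by positivity, by positivity, by field_simp,
      rfl⟩ (-r / (p + s)))
    obtain rfl : q = 1 - (p + s) := by linarith
    have h3 : (p + s) • b = p • a + s • c + (-r) • d := by
      linear_combination (norm := module) h2 - hxb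
    have h4 : b = (p + s)⁻¹ • (p • a + s • c + (-r) • d) := by
      rw [← h3, inv_smul_smul₀ h0.ne']
    rw [h4]
    module

/-- The knot obtained from `r ∪ w` by letting the underpass `w` drop from its vertex `w i` to the
level `h`, continue there straight to the other rail, and rise along the rail. -/
def cutShort (ℓ : R3 →ₗ[ℝ] ℝ) (d : R3) (n : ℕ) (v : ℕ → R3) (m : ℕ) (w : ℕ → R3) (i : ℕ)
    (h : ℝ) : Set R3 :=
  sticks n v ∪ sticks i w ∪ segment ℝ (w i) (dropTo ℓ d (w i) h) ∪
    segment ℝ (dropTo ℓ d (w i) h) (dropTo ℓ d (w m) h) ∪ segment ℝ (w m) (dropTo ℓ d (w m) h)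

section

variable {ℓ : R3 →ₗ[ℝ] ℝ} {d : R3} {n m : ℕ} {v w : ℕ → R3}

theorem exists_of_mem_column {a y : R3} {t : ℝ} (hy : y ∈ segment ℝ a (dropTo ℓ d a t)) :
    ∃ u : ℝ, a = y + u • d := by
  obtain ⟨u, rfl⟩ := exists_of_mem_segment_dropTo hy
  exact ⟨-u, by module⟩

theorem ne_zero_of_height_eq_one (hd : ℓ d = 1) : d ≠ 0 := by
  rintro rfl
  simp at hd

theorem ne_column_of_mem_column {a b y : R3} {h k : ℝ} (hab : ∀ r : ℝ, b - a ≠ r • d)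
    (hy : y ∈ segment ℝ a (dropTo ℓ d a h)) (r : ℝ) : dropTo ℓ d b k ≠ y + r • d := by
  obtain ⟨u, hu⟩ := exists_of_mem_column hy
  intro h'
  refine hab (r - (k - ℓ b) - u) ?_
  rw [dropTo] at h'
  linear_combination (norm := module) h' - hu

/-- Two triangles in the curtain below the last stick suffice: the first pulls the stick's end down
the rail, the second drops its start. -/
theorem knotEquiv_cutShort_last (hd : ℓ d = 1) (hw : IsUnderpass d n v (m + 1) w)
    {h : ℝ} (h1 : h < ℓ (w m)) (h2 : h < ℓ (w (m + 1))) :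
    KnotEquiv (sticks n v ∪ sticks (m + 1) w) (cutShort ℓ d n v (m + 1) w m h) := by
  have hd0 := ne_zero_of_height_eq_one hd
  have hne : ∀ r : ℝ, w (m + 1) - w m ≠ r • d := hw.vertex_ne le_rfl m.lt_succ_self (by omega)
  have hR := fun x hx => hw.eq_of_mem_curtain (x := x) m.lt_succ_self hx
  set U := w m with hU
  set T := w (m + 1) with hT
  have hcurt := convex_curtain d U T
  have hUc := segment_subset_curtain d U T (left_mem_segment _ _ _)
  have hTc := segment_subset_curtain d U T (right_mem_segment _ _ _)
  have hUc' := left_mem_curtain d U T h1.le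
  have hTc' := right_mem_curtain d U T h2.le
  have e1 : KnotEquiv (sticks n v ∪ sticks m w ∪ segment ℝ U T)
      (sticks n v ∪ sticks m w ∪ (segment ℝ U (dropTo ℓ d T h) ∪ segment ℝ (dropTo ℓ d T h) T)) := by
    refine knotEquiv_triangle
      (affineIndependent_of_vertical_right hd0 hne (sub_ne_zero.2 h2.ne) rfl) fun x hx hx' => ?_
    rcases hR x hx (triangle_subset hcurt hUc hTc hTc' hx') with h | h
    · exact Or.inl h
    · exact Or.inr h.2
  have hne' : ∀ r : ℝ, dropTo ℓ d T h - U ≠ r • d := fun r hr =>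
    hne (r - (h - ℓ T)) (by rw [dropTo] at hr; linear_combination (norm := module) hr)
  -- The new column along the rail now belongs to the rest of the knot; it touches the second
  -- triangle only in its foot.
  have hcol : ∀ x ∈ convexHull ℝ {U, dropTo ℓ d T h, dropTo ℓ d U h}, ∀ r : ℝ, x = T + r • d →
      x = dropTo ℓ d T h := by
    intro x hx r hr
    refine eq_vertex_of_mem_column (d := d) (r := r - (h - ℓ T))
      (fun y hy r => ne_column_of_mem_column hne hy r) hx ?_
    rw [hr, dropTo]; module
  have e2 : KnotEquiv (sticks n v ∪ sticks m w ∪ segment ℝ T (dropTo ℓ d T h) ∪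
        segment ℝ U (dropTo ℓ d T h))
      (sticks n v ∪ sticks m w ∪ segment ℝ T (dropTo ℓ d T h) ∪
        (segment ℝ U (dropTo ℓ d U h) ∪ segment ℝ (dropTo ℓ d U h) (dropTo ℓ d T h))) := by
    refine knotEquiv_triangle
      (affineIndependent_of_vertical_left hd0 hne' (sub_ne_zero.2 h1.ne) rfl) fun x hx hx' => ?_
    rcases hx with hx | hx
    · rcases hR x hx (triangle_subset hcurt hUc hTc' hUc' hx') with h | h
      · exact Or.inl h
      · exact Or.inr (hcol x hx' 0 (by simpa using h.2))
    · obtain ⟨r, hr⟩ := exists_of_mem_segment_dropTo hx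
      exact Or.inr (hcol x hx' r hr)
  convert e1.trans ?_ using 1
  · rw [sticks_succ, Set.union_assoc]
  · convert e2 using 1
    · rw [segment_symm ℝ (dropTo ℓ d T h) T]
      ac_rfl
    · rw [cutShort]
      ac_rfl

/-- Write `U = w i`, `V = w (i + 1)`, `T = w m`. Four moves lead from the old path `U, V`, foot of
`V`, foot of `T`, `T` to the new one. The strict inequality `h < h'` makes the foot of `V` the only
lowest point of the triangles in the curtain, so the old crossing at level `h`, which may run
underneath `[U, V]`, cannot cut them. -/
theorem knotEquiv_cutShort_succ (hd : ℓ d = 1) (hw : IsUnderpass d n v m w) {i : ℕ}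
    (hi : i + 1 < m) {h h' : ℝ} (hh : h < h') (hlow : ∀ x ∈ sticks n v ∪ sticks m w, h' < ℓ x) :
    KnotEquiv (cutShort ℓ d n v m w (i + 1) h) (cutShort ℓ d n v m w i h') := by
  have hd0 := ne_zero_of_height_eq_one hd
  have hVU : ∀ r : ℝ, w (i + 1) - w i ≠ r • d := hw.vertex_ne hi.le (by omega) (by omega)
  have hUV : ∀ r : ℝ, w i - w (i + 1) ≠ r • d := hw.vertex_ne (by omega) hi (by omega)
  have hTU : ∀ r : ℝ, w m - w i ≠ r • d := hw.vertex_ne le_rfl (by omega) (by omega)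
  have hTV : ∀ r : ℝ, w m - w (i + 1) ≠ r • d := hw.vertex_ne le_rfl hi (by omega)
  -- Only the last stick reaches the rail through `w m`, and stick `i` is not the last.
  have hlast : ∀ y ∈ curtain d (w i) (w (i + 1)), ∀ r : ℝ, w m ≠ y + r • d := by
    rintro z ⟨y, hy, u, -, hu⟩ r hr
    refine hi.ne (hw.last_eq (u := r - u) (by omega) hy ?_)
    rw [hr, hu]; module
  have hR : ∀ x ∈ sticks n v ∪ sticks i w, x ∈ curtain d (w i) (w (i + 1)) → x = w i := by
    intro x hx hx'
    rcases hw.eq_of_mem_curtain (by omega) hx hx' with h | h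
    · exact h
    · exact absurd h.1 hi.ne
  have hU' : h' < ℓ (w i) := hlow _ (Or.inr (vertex_mem_sticks (by omega) (by omega) w))
  have hV' : h' < ℓ (w (i + 1)) := hlow _ (Or.inr (vertex_mem_sticks (by omega) hi.le w))
  have hT' : h' < ℓ (w m) := hlow _ (Or.inr (vertex_mem_sticks (by omega) le_rfl w))
  have hlow' : ∀ x ∈ sticks n v ∪ sticks i w, h' < ℓ x := fun x hx =>
    hlow x (Set.union_subset_union_right _ (sticks_mono (by omega) w) hx)
  have hs : sticks (i + 1) w = sticks i w ∪ segment ℝ (w i) (w (i + 1)) := sticks_succ i w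
  rw [cutShort, cutShort, hs]
  set R := sticks n v ∪ sticks i w with hRdef
  set U := w i with hU
  set V := w (i + 1) with hV
  set T := w m with hT
  have hcurt := convex_curtain d U V
  have hUc := segment_subset_curtain d U V (left_mem_segment _ _ _)
  have hVc := segment_subset_curtain d U V (right_mem_segment _ _ _)
  have hUc' := left_mem_curtain d U V hU'.le
  have hVc' := right_mem_curtain d U V (hh.trans hV').le
  have lU : ℓ (dropTo ℓ d U h') = h' := height_dropTo hd _ _
  have lV : ℓ (dropTo ℓ d V h) = h := height_dropTo hd _ _
  have lB : ℓ (dropTo ℓ d T h) = h := height_dropTo hd _ _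
  have lB' : ℓ (dropTo ℓ d T h') = h' := height_dropTo hd _ _
  have hsplit := segment_eq_union (dropTo_mem_segment (d := d) hh hT')
  have hne : ∀ r : ℝ, dropTo ℓ d V h - U ≠ r • d := fun r hr =>
    hVU (r - (h - ℓ V)) (by rw [dropTo] at hr; linear_combination (norm := module) hr)
  have hne' : ∀ r : ℝ, dropTo ℓ d T h' - dropTo ℓ d U h' ≠ r • d := fun r hr =>
    hTU (r - (h' - ℓ T) + (h' - ℓ U))
      (by simp only [dropTo] at hr; linear_combination (norm := module) hr)
  have hneB : dropTo ℓ d T h ≠ dropTo ℓ d V h := fun hr =>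
    hTV ((h - ℓ V) - (h - ℓ T))
      (by simp only [dropTo] at hr; linear_combination (norm := module) hr)
  have hcT : ∀ x ∈ segment ℝ T (dropTo ℓ d T h), x ∉ curtain d U V := by
    intro x hx hx'
    obtain ⟨u, hu⟩ := exists_of_mem_column hx
    exact hlast x hx' u hu
  -- Used backwards: the corner at `V` is cut off by the segment from `U` to the foot of `V`.
  have e1 : KnotEquiv (R ∪ segment ℝ (dropTo ℓ d V h) (dropTo ℓ d T h) ∪
        segment ℝ T (dropTo ℓ d T h) ∪ segment ℝ U (dropTo ℓ d V h))
      (R ∪ segment ℝ (dropTo ℓ d V h) (dropTo ℓ d T h) ∪ segment ℝ T (dropTo ℓ d T h) ∪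
        (segment ℝ U V ∪ segment ℝ V (dropTo ℓ d V h))) := by
    refine knotEquiv_triangle (affineIndependent_of_vertical_right (u := -(h - ℓ V)) hd0 hne
      (neg_ne_zero.2 (sub_ne_zero.2 (hh.trans hV').ne)) (by rw [dropTo]; module))
      fun x hx hx' => ?_
    have hxc := triangle_subset hcurt hUc hVc' hVc hx'
    rcases hx with (hx | hx) | hx
    · exact Or.inl (hR x hx hxc)
    · refine Or.inr (eq_apex_of_height_le (ℓ := ℓ) ?_ ?_ hx' ?_)
      · rw [lV]; exact hh.trans hU'
      · rw [lV]; exact hh.trans hV'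
      · rw [lV, height_eq_of_mem_segment hx lV lB]
    · exact absurd hxc (hcT x hx)
  -- That segment is bent so that it first drops vertically from `U` to level `h'`.
  have e2 : KnotEquiv (R ∪ segment ℝ (dropTo ℓ d V h) (dropTo ℓ d T h) ∪
        segment ℝ T (dropTo ℓ d T h) ∪ segment ℝ U (dropTo ℓ d V h))
      (R ∪ segment ℝ (dropTo ℓ d V h) (dropTo ℓ d T h) ∪ segment ℝ T (dropTo ℓ d T h) ∪
        (segment ℝ U (dropTo ℓ d U h') ∪ segment ℝ (dropTo ℓ d U h') (dropTo ℓ d V h))) := by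
    refine knotEquiv_triangle
      (affineIndependent_of_vertical_left hd0 hne (sub_ne_zero.2 hU'.ne) rfl) fun x hx hx' => ?_
    have hxc := triangle_subset hcurt hUc hVc' hUc' hx'
    rcases hx with (hx | hx) | hx
    · exact Or.inl (hR x hx hxc)
    · refine Or.inr (eq_apex_of_height_le (ℓ := ℓ) ?_ ?_ hx' ?_)
      · rw [lV]; exact hh.trans hU'
      · rw [lV, lU]; exact hh
      · rw [lV, height_eq_of_mem_segment hx lV lB]
    · exact absurd hxc (hcT x hx)
  have hUU : ∀ x ∈ segment ℝ U (dropTo ℓ d U h'), ℓ x ≤ h' → x = dropTo ℓ d U h' := by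
    intro x hx hx'
    rw [segment_symm] at hx
    exact eq_left_of_height_le (by rw [lU]; exact hU') hx (by rw [lU]; exact hx')
  have hTT : ∀ x ∈ segment ℝ T (dropTo ℓ d T h'), ℓ x ≤ h' → x = dropTo ℓ d T h' := by
    intro x hx hx'
    rw [segment_symm] at hx
    exact eq_left_of_height_le (by rw [lB']; exact hT') hx (by rw [lB']; exact hx')
  -- Used backwards: the foot of `V` is removed. The triangle lies at or below `h'`, so only the two
  -- columns can touch it.
  have e3 : KnotEquiv (R ∪ segment ℝ U (dropTo ℓ d U h') ∪ segment ℝ T (dropTo ℓ d T h) ∪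
        segment ℝ (dropTo ℓ d U h') (dropTo ℓ d T h))
      (R ∪ segment ℝ U (dropTo ℓ d U h') ∪ segment ℝ T (dropTo ℓ d T h) ∪
        (segment ℝ (dropTo ℓ d U h') (dropTo ℓ d V h) ∪
          segment ℝ (dropTo ℓ d V h) (dropTo ℓ d T h))) := by
    refine knotEquiv_triangle (affineIndependent_of_level ℓ hneB (by rw [lB, lV])
      (by rw [lB, lU]; exact hh.ne')) fun x hx hx' => ?_
    have hx1 : ℓ x ≤ h' := height_le_of_mem_triangle hx' lU.le (by rw [lB]; exact hh.le)
      (by rw [lV]; exact hh.le)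
    rcases hx with (hx | hx) | hx
    · exact absurd hx1 (hlow' x hx).not_ge
    · exact Or.inl (hUU x hx hx1)
    · obtain ⟨r, hr⟩ := exists_of_mem_segment_dropTo hx
      refine Or.inr (eq_vertex_of_mem_column (d := d) (r := r - (h - ℓ T)) ?_ hx' ?_)
      · intro y hy r hr
        refine hlast y (hcurt.segment_subset hUc' hVc' hy) (r - (h - ℓ T)) ?_
        rw [dropTo] at hr
        linear_combination (norm := module) hr
      · rw [hr, dropTo]; module
  -- Used backwards: the crossing's end is raised from `h` to `h'`, which shortens the column below
  -- `T`.
  have e4 : KnotEquiv (R ∪ segment ℝ U (dropTo ℓ d U h') ∪ segment ℝ T (dropTo ℓ d T h') ∪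
        segment ℝ (dropTo ℓ d U h') (dropTo ℓ d T h'))
      (R ∪ segment ℝ U (dropTo ℓ d U h') ∪ segment ℝ T (dropTo ℓ d T h') ∪
        (segment ℝ (dropTo ℓ d U h') (dropTo ℓ d T h) ∪
          segment ℝ (dropTo ℓ d T h) (dropTo ℓ d T h'))) := by
    refine knotEquiv_triangle (affineIndependent_of_vertical_right (u := h - h') hd0 hne'
      (sub_ne_zero.2 hh.ne) (by simp only [dropTo]; module)) fun x hx hx' => ?_
    have hx1 : ℓ x ≤ h' := height_le_of_mem_triangle hx' lU.le lB'.le (by rw [lB]; exact hh.le)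
    rcases hx with (hx | hx) | hx
    · exact absurd hx1 (hlow' x hx).not_ge
    · exact Or.inl (hUU x hx hx1)
    · exact Or.inr (hTT x hx hx1)
  convert e1.symm.trans (e2.trans ?_) using 1
  · simp only [hRdef]; ac_rfl
  · convert e3.symm.trans ?_ using 1
    · ac_rfl
    · convert e4.symm using 1
      · rw [hsplit, segment_symm ℝ (dropTo ℓ d T h') (dropTo ℓ d T h)]
        ac_rfl
      · ac_rfl

/-- The companion of a rail arc can be formed with the underpass that drops along one rail, runs
straight to the other rail at a low level, and rises along that rail. -/
theorem knotEquiv_cutShort_zero (hd : ℓ d = 1) (hm : 0 < m) (hw : IsUnderpass d n v m w)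
    {h : ℝ} (hlow : ∀ x ∈ sticks n v ∪ sticks m w, h < ℓ x) :
    KnotEquiv (sticks n v ∪ sticks m w) (cutShort ℓ d n v m w 0 h) := by
  -- Each absorbed stick must raise the level strictly. Level `h - i` for the cut at `w i` does this
  -- and ends at `h`.
  have key : ∀ i j, i + j + 1 = m →
      KnotEquiv (sticks n v ∪ sticks m w) (cutShort ℓ d n v m w i (h - i)) := by
    intro i j
    induction j generalizing i with
    | zero =>
      rintro rfl
      have hi : (0 : ℝ) ≤ i := by positivity
      refine knotEquiv_cutShort_last hd hw ?_ ?_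
      · linarith [hlow _ (Or.inr (vertex_mem_sticks (i := i) (by omega) (by omega) w))]
      · linarith [hlow _ (Or.inr (vertex_mem_sticks (i := i + 1) (by omega) (by omega) w))]
    | succ j ih =>
      intro hij
      have hi : (0 : ℝ) ≤ i := by positivity
      refine (ih (i + 1) (by omega)).trans
        (knotEquiv_cutShort_succ hd hw (by omega) ?_ fun x hx => ?_)
      · push_cast; linarith
      · linarith [hlow x hx]
  simpa using key 0 (m - 1) (by omega)

end

/-! ### Simple arcs and simple closed polygons -/

theorem stickPoint_update_of_lt {v : ℕ → R3} {n i : ℕ} (hi : i < n) (c : R3) (s : ℝ) :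
    stickPoint (Function.update v (n + 1) c) i s = stickPoint v i s := by
  rw [stickPoint, stickPoint, Function.update_of_ne (by omega), Function.update_of_ne (by omega)]

theorem stickPoint_update_self (v : ℕ → R3) (n : ℕ) (c : R3) (s : ℝ) :
    stickPoint (Function.update v (n + 1) c) n s = AffineMap.lineMap (v n) c s := by
  rw [stickPoint, Function.update_of_ne (by omega), Function.update_self]

theorem sticks_update (v : ℕ → R3) (n : ℕ) (c : R3) :
    sticks (n + 1) (Function.update v (n + 1) c) = sticks n v ∪ segment ℝ (v n) c := by
  rw [sticks_succ, Function.update_self, Function.update_of_ne (by omega)]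
  congr 1
  ext x
  refine exists_congr fun i => and_congr_right fun hi => ?_
  rw [Function.update_of_ne (by omega), Function.update_of_ne (by omega)]

theorem stickPoint_mem_sticks {n i : ℕ} (hi : i < n) (v : ℕ → R3) {s : ℝ}
    (hs : s ∈ Set.Icc (0 : ℝ) 1) : stickPoint v i s ∈ sticks n v :=
  ⟨i, hi, mem_segment_iff_stickPoint.2 ⟨s, hs, rfl⟩⟩

theorem lineMap_mem_segment (a b : R3) {s : ℝ} (hs : s ∈ Set.Icc (0 : ℝ) 1) :
    AffineMap.lineMap a b s ∈ segment ℝ a b := by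
  rw [segment_eq_image_lineMap]
  exact Set.mem_image_of_mem _ hs

theorem IsStickArc.eq_of_stickPoint_eq_last {n : ℕ} {v : ℕ → R3} (hv : IsStickArc n v) {i : ℕ}
    (hi : i < n) {s : ℝ} (hs : s ∈ Set.Icc (0 : ℝ) 1) (h : stickPoint v i s = v n) :
    (i : ℝ) + s = n := by
  obtain ⟨k, rfl⟩ := Nat.exists_eq_add_one_of_ne_zero (Nat.ne_zero_of_lt hi)
  have := hv i hi k k.lt_succ_self s hs 1 (by simp) (by simpa using h)
  rw [this]; push_cast; rfl

/-- `S` is a simple polygonal arc from `a` to `b` with `n` sticks. -/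
def IsArcBetween (n : ℕ) (a b : R3) (S : Set R3) : Prop :=
  ∃ v : ℕ → R3, v 0 = a ∧ v n = b ∧ IsStickArc n v ∧ sticks n v = S

/-- The only coincidence between the old arc and the new stick is at `b`, which has parameter `n` on
both. -/
theorem IsArcBetween.snoc {n : ℕ} {a b c : R3} {S : Set R3} (h : IsArcBetween n a b S)
    (hbc : b ≠ c) (hS : ∀ x ∈ S, x ∈ segment ℝ b c → x = b) :
    IsArcBetween (n + 1) a c (S ∪ segment ℝ b c) := by
  obtain ⟨v, rfl, rfl, hv, rfl⟩ := h
  have key : ∀ i < n, ∀ s ∈ Set.Icc (0 : ℝ) 1, ∀ t ∈ Set.Icc (0 : ℝ) 1,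
      stickPoint v i s = AffineMap.lineMap (v n) c t → (i : ℝ) + s = n + t := by
    intro i hi s hs t ht hst
    have h1 := hS _ (stickPoint_mem_sticks hi v hs) (hst ▸ lineMap_mem_segment _ _ ht)
    have h2 := hv.eq_of_stickPoint_eq_last hi hs h1
    rw [hst, AffineMap.lineMap_eq_left_iff] at h1
    rw [h2, h1.resolve_left hbc, add_zero]
  refine ⟨Function.update v (n + 1) c, Function.update_of_ne (by omega) _ _,
    Function.update_self _ _ _, ?_, sticks_update v n c⟩
  intro i hi j hj s hs t ht hst
  rcases Nat.lt_succ_iff_lt_or_eq.1 hi with hi | rfl <;>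
    rcases Nat.lt_succ_iff_lt_or_eq.1 hj with hj | rfl
  · rw [stickPoint_update_of_lt hi, stickPoint_update_of_lt hj] at hst
    exact hv i hi j hj s hs t ht hst
  · rw [stickPoint_update_of_lt hi, stickPoint_update_self] at hst
    exact key i hi s hs t ht hst
  · rw [stickPoint_update_of_lt hj, stickPoint_update_self] at hst
    exact (key j hj t ht s hs hst.symm).symm
  · rw [stickPoint_update_self, stickPoint_update_self] at hst
    rw [AffineMap.lineMap_injective ℝ hbc hst]

theorem IsArcBetween.isStickKnot {n : ℕ} {a b : R3} {S : Set R3} (h : IsArcBetween n a b S)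
    (hn : 2 ≤ n) (hba : b ≠ a) (hS : ∀ x ∈ S, x ∈ segment ℝ b a → x = b ∨ x = a) :
    IsStickKnot (n + 1) (S ∪ segment ℝ b a) := by
  obtain ⟨v, rfl, rfl, hv, rfl⟩ := h
  -- The half-open parameters exclude both contacts: `b` would need `s = 1` on the last stick, `a`
  -- would need `t = 1` on the closing one.
  have key : ∀ i < n, ∀ s ∈ Set.Ico (0 : ℝ) 1, ∀ t ∈ Set.Ico (0 : ℝ) 1,
      stickPoint v i s ≠ AffineMap.lineMap (v n) (v 0) t := by
    intro i hi s hs t ht hst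
    rcases hS _ (stickPoint_mem_sticks hi v (Set.Ico_subset_Icc_self hs))
      (hst ▸ lineMap_mem_segment _ _ (Set.Ico_subset_Icc_self ht)) with h1 | h1
    · have h2 := hv.eq_of_stickPoint_eq_last hi (Set.Ico_subset_Icc_self hs) h1
      have h3 : (i : ℝ) + 1 ≤ n := by exact_mod_cast hi
      linarith [hs.2]
    · rw [hst, AffineMap.lineMap_eq_right_iff] at h1
      exact ht.2.ne (h1.resolve_left hba)
  refine ⟨by omega, Function.update v (n + 1) (v 0), ?_, (sticks_update v n _).symm, ?_⟩
  · rw [Function.update_self, Function.update_of_ne (by omega)]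
  intro i hi j hj s hs t ht hst
  rcases Nat.lt_succ_iff_lt_or_eq.1 hi with hi | rfl <;>
    rcases Nat.lt_succ_iff_lt_or_eq.1 hj with hj | rfl
  · rw [stickPoint_update_of_lt hi, stickPoint_update_of_lt hj] at hst
    have h1 := hv i hi j hj s (Set.Ico_subset_Icc_self hs) t (Set.Ico_subset_Icc_self ht) hst
    have h2 : i < j + 1 := by
      have : (i : ℝ) < j + 1 := by linarith [hs.1, ht.2]
      exact_mod_cast this
    have h3 : j < i + 1 := by
      have : (j : ℝ) < i + 1 := by linarith [ht.1, hs.2]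
      exact_mod_cast this
    obtain rfl : i = j := by omega
    exact ⟨rfl, by linarith⟩
  · rw [stickPoint_update_of_lt hi, stickPoint_update_self] at hst
    exact absurd hst (key i hi s hs t ht)
  · rw [stickPoint_update_of_lt hj, stickPoint_update_self] at hst
    exact absurd hst.symm (key j hj t ht s hs)
  · rw [stickPoint_update_self, stickPoint_update_self] at hst
    exact ⟨rfl, AffineMap.lineMap_injective ℝ hba hst⟩

/-! ### The cubic lattice -/

theorem mem_cubicLattice_iff {x : R3} :
    x ∈ cubicLattice ↔ ∃ k, ∀ j, j ≠ k → ∃ a : ℤ, x j = a := by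
  simp only [cubicLattice, Set.mem_ofPred_eq]
  constructor
  · rintro (⟨a, b, h1, h2⟩ | ⟨a, b, h1, h2⟩ | ⟨a, b, h1, h2⟩)
    · exact ⟨0, fun j hj => by fin_cases j; exacts [absurd rfl hj, ⟨a, h1⟩, ⟨b, h2⟩]⟩
    · exact ⟨1, fun j hj => by fin_cases j; exacts [⟨a, h1⟩, absurd rfl hj, ⟨b, h2⟩]⟩
    · exact ⟨2, fun j hj => by fin_cases j; exacts [⟨a, h1⟩, ⟨b, h2⟩, absurd rfl hj]⟩
  · rintro ⟨k, hk⟩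
    fin_cases k
    · obtain ⟨a, ha⟩ := hk 1 (by decide)
      obtain ⟨b, hb⟩ := hk 2 (by decide)
      exact Or.inl ⟨a, b, ha, hb⟩
    · obtain ⟨a, ha⟩ := hk 0 (by decide)
      obtain ⟨b, hb⟩ := hk 2 (by decide)
      exact Or.inr (Or.inl ⟨a, b, ha, hb⟩)
    · obtain ⟨a, ha⟩ := hk 0 (by decide)
      obtain ⟨b, hb⟩ := hk 1 (by decide)
      exact Or.inr (Or.inr ⟨a, b, ha, hb⟩)

theorem countable_setOf_mem_int (p : ℝ) {e : ℝ} (he : e ≠ 0) :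
    {t : ℝ | ∃ a : ℤ, p + t * e = a}.Countable := by
  refine (Set.countable_range fun a : ℤ => ((a : ℝ) - p) / e).mono ?_
  rintro t ⟨a, ha⟩
  exact ⟨a, by simp only; field_simp; linarith⟩

/-- A line in the cubic lattice is parallel to a coordinate axis and has integral other
coordinates. -/
theorem exists_axis {p d : R3} (hd : d ≠ 0) (h : line p d ⊆ cubicLattice) :
    ∃ k, d k ≠ 0 ∧ ∀ j, j ≠ k → d j = 0 ∧ ∃ a : ℤ, p j = a := by
  -- All but countably many points of the line have every varying coordinate non-integral. A lattice
  -- point allows one such coordinate, so only one can vary.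
  obtain ⟨t, ht⟩ : ∃ t : ℝ, ∀ j, d j ≠ 0 → ¬ ∃ a : ℤ, p j + t * d j = a := by
    have hc : (⋃ j : {j // d j ≠ 0}, {t : ℝ | ∃ a : ℤ, p j + t * d j = a}).Countable :=
      Set.countable_iUnion fun j => countable_setOf_mem_int _ j.2
    obtain ⟨t, ht⟩ := (Set.ne_univ_iff_exists_notMem _).1 fun h' =>
      Set.not_countable_univ (α := ℝ) (h' ▸ hc)
    exact ⟨t, fun j hj ha => ht (Set.mem_iUnion.2 ⟨⟨j, hj⟩, ha⟩)⟩
  obtain ⟨k, hk⟩ := mem_cubicLattice_iff.1 (h ⟨t, rfl⟩)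
  simp only [Pi.add_apply, Pi.smul_apply, smul_eq_mul] at hk
  have h0 : ∀ j, j ≠ k → d j = 0 := fun j hj => by
    by_contra h'
    exact ht j h' (hk j hj)
  refine ⟨k, fun h' => hd (funext fun j => ?_), fun j hj => ⟨h0 j hj, ?_⟩⟩
  · by_cases hj : j = k
    · rw [hj, h', Pi.zero_apply]
    · exact h0 j hj
  · simpa [h0 j hj] using hk j hj

theorem coord_eq_of_mem_segment {a b x : R3} {j : Fin 3} (hx : x ∈ segment ℝ a b)
    (h : b j = a j) : x j = a j :=
  height_eq_of_mem_segment (ℓ := LinearMap.proj j) hx rfl h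

theorem segment_subset_cubicLattice {a b : R3} (k : Fin 3)
    (h : ∀ j, j ≠ k → b j = a j ∧ ∃ z : ℤ, a j = z) : segment ℝ a b ⊆ cubicLattice :=
  fun x hx => mem_cubicLattice_iff.2 ⟨k, fun j hj => by
    rw [coord_eq_of_mem_segment hx (h j hj).1]; exact (h j hj).2⟩

theorem eq_midpoint_of_mem {a b x : R3} (hab : a ≠ b) (h1 : x ∈ segment ℝ a (midpoint ℝ a b))
    (h2 : x ∈ segment ℝ (midpoint ℝ a b) b) : x = midpoint ℝ a b := by
  obtain ⟨r, s, hr, hs, hrs, rfl⟩ := h1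
  obtain ⟨r', s', hr', hs', hrs', h⟩ := h2
  rw [midpoint_eq_smul_add] at h ⊢
  -- Relative to the midpoint, the two expressions for the point are `-(r / 2) • (b - a)` and `(s' /
  -- 2) • (b - a)`.
  have h3 : (s' / 2 + r / 2) • (b - a) = 0 := by
    obtain rfl : s = 1 - r := by linarith
    obtain rfl : r' = 1 - s' := by linarith
    linear_combination (norm := skip) h
    match_scalars <;> (norm_num; ring)
  rcases smul_eq_zero.1 h3 with h3 | h3
  · obtain rfl : r = 0 := by linarith
    obtain rfl : s = 1 := by linarith
    simp
  · exact absurd (sub_eq_zero.1 h3).symm hab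

/-- Two lattice points at the same level are joined by two lattice sticks at this level. -/
theorem exists_corner (k : Fin 3) {a b : R3} (hab : a ≠ b) (hk : b k = a k)
    (ha : ∀ j, ∃ z : ℤ, a j = z) (hb : ∀ j, ∃ z : ℤ, b j = z) :
    ∃ c : R3, c k = a k ∧ a ≠ c ∧ c ≠ b ∧
      (∀ x ∈ segment ℝ a c, x ∈ segment ℝ c b → x = c) ∧
      segment ℝ a c ⊆ cubicLattice ∧ segment ℝ c b ⊆ cubicLattice ∧
      (AffineIndependent ℝ ![a, b, c] ∨ segment ℝ a b = segment ℝ a c ∪ segment ℝ c b) := by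
  by_cases h : ∃ i, ∀ j, j ≠ i → b j = a j
  · obtain ⟨i, hi⟩ := h
    have hm : midpoint ℝ a b ∈ segment ℝ a b := midpoint_mem_segment a b
    have hl : segment ℝ a b ⊆ cubicLattice :=
      segment_subset_cubicLattice i fun j hj => ⟨hi j hj, ha j⟩
    -- If one axis-parallel stick would do, it is split at its midpoint, to keep the count at
    -- exactly two.
    refine ⟨midpoint ℝ a b, coord_eq_of_mem_segment hm hk, ?_, ?_,
      fun x => eq_midpoint_of_mem hab, ?_, ?_, Or.inr (segment_eq_union hm)⟩
    · simpa using hab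
    · simpa using hab
    · exact ((convex_segment a b).segment_subset (left_mem_segment _ _ _) hm).trans hl
    · exact ((convex_segment a b).segment_subset hm (right_mem_segment _ _ _)).trans hl
  · push Not at h
    -- The points differ in exactly the two coordinates `i`, `j` other than `k`; the corner changes
    -- `i` first, then `j`.
    obtain ⟨i, hik, hi⟩ := h k
    obtain ⟨j, hji, hj⟩ := h i
    have hjk : j ≠ k := by rintro rfl; exact hj hk
    have hall : ∀ l : Fin 3, l ≠ k → l ≠ i → l = j := by omega
    have hc : ∀ l, l ≠ i → Function.update a i (b i) l = a l := fun l hl =>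
      Function.update_of_ne hl _ _
    have hci : Function.update a i (b i) i = b i := Function.update_self _ _ _
    have hc' : ∀ l, l ≠ j → b l = Function.update a i (b i) l := by
      intro l hl
      by_cases hli : l = i
      · rw [hli, hci]
      · rw [hc l hli]
        by_cases hlk : l = k
        · rw [hlk, hk]
        · exact absurd (hall l hlk hli) hl
    have hcz : ∀ l, ∃ z : ℤ, Function.update a i (b i) l = z := by
      intro l
      by_cases hli : l = i
      · rw [hli, hci]; exact hb i
      · rw [hc l hli]; exact ha l
    refine ⟨Function.update a i (b i), hc k hik.symm, ?_, ?_, ?_,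
      segment_subset_cubicLattice i fun l hl => ⟨hc l hl, ha l⟩,
      segment_subset_cubicLattice j fun l hl => ⟨hc' l hl, hcz l⟩, Or.inl ?_⟩
    · intro h'
      exact hi (by rw [← hci, ← h'])
    · intro h'
      exact hj (by rw [← hc j hji, h'])
    · intro x hx hx'
      funext l
      by_cases hl : l = j
      · rw [hl, coord_eq_of_mem_segment hx (hc j hji), hc j hji]
      · exact coord_eq_of_mem_segment hx' (hc' l hl)
    · refine affineIndependent_triple fun s t hst => ?_
      have h1 := congrFun hst j
      have h2 := congrFun hst i
      simp only [Pi.add_apply, Pi.smul_apply, Pi.sub_apply, Pi.zero_apply, smul_eq_mul, hc j hji,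
        hci, sub_self, mul_zero, add_zero] at h1 h2
      have hs : s = 0 := (mul_eq_zero.1 h1).resolve_right (sub_ne_zero.2 hj)
      rw [hs, zero_mul, zero_add] at h2
      exact ⟨hs, (mul_eq_zero.1 h2).resolve_right (sub_ne_zero.2 hi)⟩

/-! ### Lattice rail arcs -/

theorem line_eq_of_mem {p d x : R3} (hx : x ∈ line p d) : line p d = line x d := by
  obtain ⟨t, rfl⟩ := hx
  ext y
  constructor
  · rintro ⟨s, rfl⟩
    exact ⟨s - t, by module⟩
  · rintro ⟨s, rfl⟩
    exact ⟨t + s, by module⟩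

theorem line_neg (p d : R3) : line p (-d) = line p d := by
  ext y
  constructor
  · rintro ⟨s, rfl⟩
    exact ⟨-s, by module⟩
  · rintro ⟨s, rfl⟩
    exact ⟨-s, by module⟩

theorem IsLatticeRailArc.neg {p q d : R3} {n : ℕ} {v : ℕ → R3} (h : IsLatticeRailArc p q d n v) :
    IsLatticeRailArc p q (-d) n v where
  direction_ne_zero := neg_ne_zero.2 h.direction_ne_zero
  rails_ne := by rw [line_neg, line_neg]; exact h.rails_ne
  simple := h.simple
  start_mem := by rw [line_neg]; exact h.start_mem
  end_mem := by rw [line_neg]; exact h.end_mem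
  interior_disjoint := by rw [line_neg, line_neg]; exact h.interior_disjoint
  rail_subset := by rw [line_neg]; exact h.rail_subset
  rail_subset' := by rw [line_neg]; exact h.rail_subset'
  arc_subset := h.arc_subset

theorem exists_integral_level {c : ℝ} (hc : c ≠ 0) (h : ℝ) : ∃ t < h, ∃ z : ℤ, t * c = z := by
  rcases hc.lt_or_gt with hc' | hc'
  · obtain ⟨z, hz⟩ := exists_int_gt (h * c)
    exact ⟨z / c, (div_lt_iff_of_neg hc').2 hz, z, div_mul_cancel₀ _ hc⟩
  · obtain ⟨z, hz⟩ := exists_int_lt (h * c)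
    exact ⟨z / c, (div_lt_iff₀ hc').2 hz, z, div_mul_cancel₀ _ hc⟩

theorem segment_dropTo_subset_line {ℓ : R3 →ₗ[ℝ] ℝ} {p d x : R3} {t : ℝ} (hx : x ∈ line p d) :
    segment ℝ x (dropTo ℓ d x t) ⊆ line p d := by
  rw [line_eq_of_mem hx]
  exact fun y hy => exists_of_mem_segment_dropTo hy

/-- The under companion of a lattice rail arc is represented by a lattice knot with four more
sticks. -/
theorem exists_lattice_underCompanion {p q d : R3} {n m : ℕ} {v w : ℕ → R3}
    (hv : IsLatticeRailArc p q d n v) (hw : IsUnderpass d n v m w) :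
    ∃ L : Set R3, IsStickKnot (n + 4) L ∧ L ⊆ cubicLattice ∧
      KnotEquiv L (sticks n v ∪ sticks m w) := by
  obtain ⟨k, hdk, hpk⟩ := exists_axis hv.direction_ne_zero hv.rail_subset
  have hqk : ∀ j, j ≠ k → ∃ a : ℤ, q j = a := by
    obtain ⟨k', hdk', hqk'⟩ := exists_axis hv.direction_ne_zero hv.rail_subset'
    obtain rfl : k' = k := by
      by_contra h
      exact hdk' (hpk k' h).1
    exact fun j hj => (hqk' j hj).2
  have hrails : ∀ x ∈ line p d, x ∉ line q d := fun x hp hq =>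
    hv.rails_ne (by rw [line_eq_of_mem hp, line_eq_of_mem hq])
  have hends : v n ≠ v 0 := fun h => hrails _ hv.start_mem (h ▸ hv.end_mem)
  have hn : 0 < n := Nat.pos_of_ne_zero (by rintro rfl; exact hends rfl)
  have hm : 0 < m := Nat.pos_of_ne_zero (by
    rintro rfl; exact hends (hw.start_eq.symm.trans hw.end_eq))
  -- The height is normalised to be 1 on `d`. As `d k` may be any nonzero real, what must be
  -- integral is `h * d k`, the `k`-th coordinate at level `h`, rather than `h`.
  let ℓ : R3 →ₗ[ℝ] ℝ := (d k)⁻¹ • LinearMap.proj k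
  have hℓ : ∀ x : R3, ℓ x = x k / d k := fun x => by simp [ℓ, div_eq_inv_mul]
  have hd : ℓ d = 1 := by rw [hℓ, div_self hdk]
  obtain ⟨h, hlow, z, hz⟩ : ∃ h : ℝ, (∀ x ∈ sticks n v ∪ sticks m w, h < ℓ x) ∧
      ∃ z : ℤ, h * d k = z := by
    obtain ⟨h1, hh1⟩ := exists_lt_height ℓ n v
    obtain ⟨h2, hh2⟩ := exists_lt_height ℓ m w
    obtain ⟨t, ht, z, hz⟩ := exists_integral_level hdk (min h1 h2)
    refine ⟨t, ?_, z, hz⟩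
    rintro x (hx | hx)
    · exact (ht.trans_le (min_le_left _ _)).trans (hh1 x hx)
    · exact (ht.trans_le (min_le_right _ _)).trans (hh2 x hx)
  have hlow' : ∀ x ∈ sticks n v, h < ℓ x := fun x hx => hlow x (Or.inl hx)
  have hdrop : ∀ x, dropTo ℓ d x h k = z := fun x => by
    rw [← hz, dropTo, hℓ]
    simp only [Pi.add_apply, Pi.smul_apply, smul_eq_mul]
    field_simp
    ring
  have hdropz : ∀ r x : R3, (∀ j, j ≠ k → ∃ a : ℤ, r j = a) → x ∈ line r d →
      ∀ j, ∃ a : ℤ, dropTo ℓ d x h j = a := by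
    rintro r x hr ⟨t, rfl⟩ j
    by_cases hj : j = k
    · exact ⟨z, by rw [hj, hdrop]⟩
    · simpa [dropTo, (hpk j hj).1] using hr j hj
  set A := dropTo ℓ d (v n) h with hA
  set B := dropTo ℓ d (v 0) h with hB
  have lA : ℓ A = h := height_dropTo hd _ _
  have lB : ℓ B = h := height_dropTo hd _ _
  have hn0 : h < ℓ (v n) := hlow' _ (vertex_mem_sticks hn le_rfl v)
  have h00 : h < ℓ (v 0) := hlow' _ (vertex_mem_sticks hn (by omega) v)
  have hAq : segment ℝ (v n) A ⊆ line q d := segment_dropTo_subset_line hv.end_mem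
  have hBp : segment ℝ (v 0) B ⊆ line p d := segment_dropTo_subset_line hv.start_mem
  have hAB : A ≠ B := fun h' => hrails B (hBp (right_mem_segment _ _ _))
    (h' ▸ hAq (right_mem_segment _ _ _))
  have hvA : ∀ x ∈ segment ℝ (v n) A, ℓ x ≤ h → x = A := fun x hx hx' =>
    eq_left_of_height_le (by rw [lA]; exact hn0) (segment_symm ℝ (v n) A ▸ hx) (by rwa [lA])
  have hvB : ∀ x ∈ segment ℝ (v 0) B, ℓ x ≤ h → x = B := fun x hx hx' =>
    eq_left_of_height_le (by rw [lB]; exact h00) (segment_symm ℝ (v 0) B ▸ hx) (by rwa [lB])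
  obtain ⟨C, hCk, hAC, hCB, hC, hACl, hCBl, hCeq⟩ := exists_corner k hAB
    (by rw [hA, hB, hdrop, hdrop]) (hdropz q _ hqk hv.end_mem)
    (hdropz p _ (fun j hj => (hpk j hj).2) hv.start_mem)
  have lC : ℓ C = h := by rw [hℓ, hCk, ← hℓ, lA]
  have sAC : ∀ x ∈ segment ℝ A C, ℓ x = h := fun x hx => height_eq_of_mem_segment hx lA lC
  have sCB : ∀ x ∈ segment ℝ C B, ℓ x = h := fun x hx => height_eq_of_mem_segment hx lC lB
  have hBAC : B ∉ segment ℝ A C := fun h' => hCB (hC B h' (right_mem_segment _ _ _)).symm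
  have hACB : A ∉ segment ℝ C B := fun h' => hAC (hC A (left_mem_segment _ _ _) h')
  have arc0 : IsArcBetween n (v 0) (v n) (sticks n v) := ⟨v, rfl, rfl, hv.simple, rfl⟩
  have arc1 := arc0.snoc (c := A) (by intro h'; rw [← h'] at lA; exact hn0.ne' lA) (by
    intro x hx hx'
    rcases hv.interior_disjoint x hx (Or.inr (hAq hx')) with h' | h'
    · exact absurd (h' ▸ hAq hx') (hrails _ hv.start_mem)
    · exact h')
  have arc2 := arc1.snoc hAC (by
    rintro x (hx | hx) hx'
    · exact absurd (sAC x hx') (hlow' x hx).ne'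
    · exact hvA x hx (sAC x hx').le)
  have arc3 := arc2.snoc hCB (by
    rintro x ((hx | hx) | hx) hx'
    · exact absurd (sCB x hx') (hlow' x hx).ne'
    · exact absurd (hvA x hx (sCB x hx').le ▸ hx') hACB
    · exact hC x hx hx')
  have knot := arc3.isStickKnot (by omega) (by rintro h'; rw [h'] at lB; exact h00.ne' lB) (by
    intro x hx hx'
    rw [segment_symm] at hx'
    rcases hx with ((hx | hx) | hx) | hx
    · rcases hv.interior_disjoint x hx (Or.inl (hBp hx')) with h' | h'
      · exact Or.inr h'
      · exact absurd hv.end_mem (hrails _ (h' ▸ hBp hx'))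
    · exact absurd (hAq hx) (hrails _ (hBp hx'))
    · exact absurd (hvB x hx' (sAC x hx).le ▸ hx) hBAC
    · exact Or.inl (hvB x hx' (sCB x hx).le))
  refine ⟨_, knot, ?_, ?_⟩
  · refine Set.union_subset (Set.union_subset (Set.union_subset (Set.union_subset
      hv.arc_subset (hAq.trans hv.rail_subset')) hACl) hCBl) ?_
    rw [segment_symm]
    exact hBp.trans hv.rail_subset
  · refine KnotEquiv.symm ((knotEquiv_cutShort_zero hd hm hw hlow).trans ?_)
    rw [cutShort, sticks_zero, hw.start_eq, hw.end_eq, Set.union_empty, ← hA, ← hB]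
    -- The triangle `A B C` lies at level `h`, where the rest of the knot has only the points `A`
    -- and `B`.
    have key : KnotEquiv (sticks n v ∪ segment ℝ (v n) A ∪ segment ℝ (v 0) B ∪ segment ℝ A B)
        (sticks n v ∪ segment ℝ (v n) A ∪ segment ℝ (v 0) B ∪
          (segment ℝ A C ∪ segment ℝ C B)) := by
      rcases hCeq with hi | heq
      · refine knotEquiv_triangle hi fun x hx hx' => ?_
        have hxh : ℓ x ≤ h := height_le_of_mem_triangle hx' lA.le lB.le lC.le
        rcases hx with (hx | hx) | hx
        · exact absurd hxh (hlow' x hx).not_ge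
        · exact Or.inl (hvA x hx hxh)
        · exact Or.inr (hvB x hx hxh)
      · rw [heq]; exact KnotEquiv.refl _
    convert key using 1
    · ac_rfl
    · rw [segment_symm ℝ B (v 0)]
      ac_rfl

end RailKnot

open RailKnot in
theorem mainTheorem10 (K : Set RailKnot.R3) (hK : ∃ n : ℕ, RailKnot.IsStickKnot n K) :
    RailKnot.latticeStickNumber K ≤ RailKnot.railLatticeStickNumber K + 4 := by
  by_cases hne : {N : ℕ∞ | ∃ n : ℕ, N = n ∧ ∃ (p q d : R3) (v : ℕ → R3),
      IsLatticeRailArc p q d n v ∧ (IsUnderCompanion d n v K ∨ IsOverCompanion d n v K)}.Nonempty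
  -- `ℕ∞` is well ordered, so the infimum is attained; over an empty set it is `⊤` and the bound is
  -- trivial.
  · obtain ⟨n, hn, p, q, d, v, hv, hvK⟩ := csInf_mem hne
    rw [railLatticeStickNumber, hn]
    refine sInf_le ⟨n + 4, by push_cast; rfl, ?_⟩
    rcases hvK with ⟨m, w, hw, hwK⟩ | ⟨m, w, hw, hwK⟩
    · obtain ⟨L, hL, hL', hLw⟩ := exists_lattice_underCompanion hv hw
      exact ⟨L, hL, hL', hLw.trans hwK⟩
    -- An overpass is by definition an underpass for `-d`, so the same construction applies with the
    -- direction reversed.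
    · obtain ⟨L, hL, hL', hLw⟩ := exists_lattice_underCompanion hv.neg hw
      exact ⟨L, hL, hL', hLw.trans hwK⟩
  · rw [railLatticeStickNumber, Set.not_nonempty_iff_eq_empty.1 hne, sInf_empty]
    simp
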